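/- Let $\mathbb K$ be a field of characteristic zero, let $\mathbb E=\mathbb K(x,y,z)$, and let $\sigma_x,\sigma_y,\sigma_z$ be the automorphisms of $\mathbb E$ over $\mathbb K$ with $\sigma_x f=f(x+1,y,z)$, $\sigma_y f=f(x,y+1,z)$, $\sigma_z f=f(x,y,z+1)$. A telescoper for $f\in\mathbb E$ is a nonzero operator $L=\sum_{i=0}^{\rho}\ell_iS_x^i$ with $\ell_i\in\mathbb K(x)$ such that $$L(f):=\sum_{i=0}^{\rho}\ell_i\,\sigma_x^i(f)=\bigl(\sigma_y(g)-g\bigr)+\bigl(\sigma_z(h)-h\bigr)\quad\text{for some } g,h\in\mathbb E .$$ A rational function $f\in\mathbb E$ is called proper if $f=p/q$ with $p,q\in\mathbb K[x,y,z]$, where over the algebraic closure $\overline{\mathbb K}$ the polynomial $q$ is a finite (possibly empty) product of irreducible polynomials of the form $\alpha x+\beta y+\gamma z+\delta$ with $\alpha,\beta,\gamma\in\mathbb Z$ and $\delta\in\overline{\mathbb K}$. Let $f=\dfrac{b}{c\,d^{\lambda}}$ with $\lambda\in\mathbb N$, $b,d\in\mathbb K[x,y,z]$, $c\in\mathbb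 K[x,y]$ and $c,d\neq0$, and suppose that $\sigma_x^m(d)=\sigma_y^n\sigma_z^k(d)$ for some integers $m,n,k$ with $m>0$. (i) If there are integers $n_1,n_2,k_1,k_2$ with $n_1,n_2>0$ such that $\sigma_y^{n_1}(d)=\sigma_z^{k_1}(d)$ and $\sigma_x^{n_2}(c)=\sigma_y^{k_2}(c)$, then $f$ is proper and has a telescoper. (ii) If there is a positive integer $t$ such that $\sigma_x^{tm}(c)=\sigma_y^{tn}(c)$, then $f$ has a telescoper. -/

import Mathlib

noncomputable section

namespace Telescoper

open MvPolynomial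

/-- The polynomial ring `K[x, y, z]`; the variables `x, y, z` are `X 0, X 1, X 2`. -/
abbrev Poly3 (K : Type*) [Field K] : Type _ := MvPolynomial (Fin 3) K

/-- The field `E = K(x, y, z)` of rational functions. -/
abbrev Rat3 (K : Type*) [Field K] : Type _ := FractionRing (Poly3 K)

/-- The shift by one in the variable `X v`, an automorphism of `K[x, y, z]`. -/
def polyShift (K : Type*) [Field K] (v : Fin 3) : Poly3 K ≃ₐ[K] Poly3 K :=
  AlgEquiv.ofAlgHom
    (aeval fun i => if i = v then X i + 1 else X i)
    (aeval fun i => if i = v then X i - 1 else X i)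
    (by
      ext1 i
      by_cases h : i = v <;> simp [h])
    (by
      ext1 i
      by_cases h : i = v <;> simp [h])

/-- The shift by one in the variable `X v`, extended to `K(x, y, z)`. -/
def ratShift (K : Type*) [Field K] (v : Fin 3) : Rat3 K ≃ₐ[K] Rat3 K :=
  IsFractionRing.fieldEquivOfAlgEquiv K (Rat3 K) (Rat3 K) (polyShift K v)

/-- The canonical embedding of `K[x, y, z]` into `K(x, y, z)`. -/
abbrev toRat (K : Type*) [Field K] : Poly3 K →+* Rat3 K := algebraMap (Poly3 K) (Rat3 K)

/-- The subfield `K(x)` of `K(x, y, z)`. -/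
def ratX (K : Type*) [Field K] : IntermediateField K (Rat3 K) :=
  IntermediateField.adjoin K {toRat K (X 0)}

/-- A linear recurrence operator `L = ∑ i, ℓ i * S_x ^ i` in `K(x)[S_x]`, given by its
finitely supported sequence of coefficients `ℓ i ∈ K(x)`. -/
abbrev RecOp (K : Type*) [Field K] : Type _ := ℕ →₀ ratX K

/-- The action `L(f) = ∑ i, ℓ i * f(x + i, y, z)` of an operator on a rational function. -/
def RecOp.apply {K : Type*} [Field K] (L : RecOp K) (f : Rat3 K) : Rat3 K :=
  L.sum fun i a => (a : Rat3 K) * (ratShift K 0 ^ i) f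

/-- `(σ_y, σ_z)`-summability: `f = Δ_y(g) + Δ_z(h)` for some `g, h ∈ K(x, y, z)`. -/
def IsSummable {K : Type*} [Field K] (f : Rat3 K) : Prop :=
  ∃ g h : Rat3 K, f = (ratShift K 1 g - g) + (ratShift K 2 h - h)

/-- `L` is a telescoper for `f`. -/
def IsTelescoper {K : Type*} [Field K] (L : RecOp K) (f : Rat3 K) : Prop :=
  L ≠ 0 ∧ IsSummable (L.apply f)

/-- `f` has a telescoper in `K(x)[S_x]`. -/
def HasTelescoper {K : Type*} [Field K] (f : Rat3 K) : Prop :=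
  ∃ L : RecOp K, IsTelescoper L f

/-- An irreducible polynomial of the form `α x + β y + γ z + δ` with `α, β, γ ∈ ℤ`, `δ ∈ F`. -/
def IsIntegerLinear {F : Type*} [Field F] (q : Poly3 F) : Prop :=
  Irreducible q ∧ ∃ (α β γ : ℤ) (δ : F),
    q = C (α : F) * X 0 + C (β : F) * X 1 + C (γ : F) * X 2 + C δ

/-- `f` is proper: `f = p / q` with `p, q ∈ K[x, y, z]`, where over the algebraic closure of `K`
the denominator `q` is a finite product of integer-linear polynomials. -/
def IsProper {K : Type*} [Field K] (f : Rat3 K) : Prop :=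
  ∃ p q : Poly3 K, f = toRat K p / toRat K q ∧
    ∃ s : Multiset (Poly3 (AlgebraicClosure K)), (∀ r ∈ s, IsIntegerLinear r) ∧
      MvPolynomial.map (algebraMap K (AlgebraicClosure K)) q = s.prod

end Telescoper

end

/-! A shift identity says that a polynomial has an integer period vector.

Telescopers: let `q` be fixed by the translation τ along `(M, j, l)` with `M > 0`. Modulo summable
functions σ_y and σ_z act trivially, so σ_x^(iM)(b/q) is congruent to τ^i(b)/q. The τ^i(b) have
bounded total degree, hence are linearly dependent over `K`, and a dependency is a telescoper with
constant coefficients (`hasTelescoper_div`). Both parts thus reduce to a common period of `c` and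
`d` with positive `x`-entry. Only the `x`- and `y`-entries must be matched, since `c` is free of
`z`.

Properness: in characteristic zero a period makes a polynomial constant along the whole line it
spans. Two independent periods leave a univariate polynomial in one integer linear form, which
splits over the algebraic closure (`isIntegerLinearProduct_aeval`). -/

namespace Telescoper

open MvPolynomial

/-! ### Translations of polynomials and their periods -/

section Translation

variable {K : Type*} [Field K] {ι : Type*}

/-- The translation `p ↦ p(X + v)` of polynomials. -/
noncomputable def translate (v : ι → K) : MvPolynomial ι K →ₐ[K] MvPolynomial ι K :=
  aeval fun i => X i + C (v i)

@[simp]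
theorem translate_X (v : ι → K) (i : ι) : translate v (X i) = X i + C (v i) := by
  simp [translate]

theorem translate_translate (v w : ι → K) (p : MvPolynomial ι K) :
    translate v (translate w p) = translate (v + w) p := by
  have h : (translate v).comp (translate w) = translate (v + w) := by
    ext1 i
    simp [algHom_C, algebraMap_eq, add_comm, add_left_comm]
  exact DFunLike.congr_fun h p

theorem translate_zero (p : MvPolynomial ι K) : translate (0 : ι → K) p = p := by
  have h : translate (0 : ι → K) = AlgHom.id K _ := by
    ext1 i
    simp
  exact DFunLike.congr_fun h p

theorem translate_pow (v : ι → K) (j : ℕ) (p : MvPolynomial ι K) :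
    (translate v ^ j) p = translate (j • v) p := by
  induction j with
  | zero => simp [translate_zero]
  | succ j ih =>
    rw [pow_succ', AlgHom.mul_apply, ih, translate_translate, succ_nsmul']

theorem totalDegree_translate_le (v : ι → K) (p : MvPolynomial ι K) :
    (translate v p).totalDegree ≤ p.totalDegree := by
  rw [translate, aeval_def, eval₂_eq]
  refine totalDegree_finsetSum_le fun s hs => ?_
  refine (totalDegree_mul _ _).trans ?_
  rw [algebraMap_eq, totalDegree_C, zero_add]
  refine (totalDegree_finsetProd _ _).trans ((Finset.sum_le_sum fun i _ => ?_).trans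
    (le_totalDegree hs))
  refine (totalDegree_pow _ _).trans (mul_le_of_le_one_right (Nat.zero_le _) ?_)
  refine (totalDegree_add _ _).trans ?_
  simp

theorem translate_eq_self_of_add {v w : ι → K} {p : MvPolynomial ι K}
    (h : translate v p = translate w p) : translate (v - w) p = p := by
  have := congrArg (translate (-w)) h
  rwa [translate_translate, translate_translate, neg_add_cancel, translate_zero,
    neg_add_eq_sub] at this

theorem translate_nsmul_eq_self {v : ι → K} {p : MvPolynomial ι K}
    (h : translate v p = p) (j : ℕ) : translate (j • v) p = p := by
  induction j with
  | zero => simp [translate_zero]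
  | succ j ih => rw [succ_nsmul, ← translate_translate, h, ih]

theorem translate_zsmul_eq_self {v : ι → K} {p : MvPolynomial ι K}
    (h : translate v p = p) (j : ℤ) : translate (j • v) p = p := by
  have hneg : translate (-v) p = p := by
    nth_rewrite 1 [← h]
    rw [translate_translate, neg_add_cancel, translate_zero]
  cases j with
  | ofNat j => simpa using translate_nsmul_eq_self h j
  | negSucc j => rw [negSucc_zsmul, ← smul_neg]; exact translate_nsmul_eq_self hneg (j + 1)

/-- In characteristic zero, a polynomial invariant under the translation by `v` is invariant
under `X ↦ X + s v` for all polynomials `s`, at every polynomial point. -/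
theorem aeval_add_mul_of_translate_eq_self [CharZero K] {v : ι → K} {p : MvPolynomial ι K}
    (h : translate v p = p) (y : ι → MvPolynomial ι K) (s : MvPolynomial ι K) :
    aeval (fun i => y i + s * C (v i)) p = aeval y p := by
  let Q : Polynomial (MvPolynomial ι K) :=
    aeval (fun i => Polynomial.C (y i) + Polynomial.X * Polynomial.C (C (v i))) p
  have hQ (t : MvPolynomial ι K) : Q.eval t = aeval (fun i => y i + t * C (v i)) p := by
    have : ((Polynomial.aeval t).restrictScalars K).comp
        (aeval (fun i => Polynomial.C (y i) + Polynomial.X * Polynomial.C (C (v i)))) =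
        aeval (R := K) (fun i => y i + t * C (v i)) := by
      ext1 i
      simp only [AlgHom.comp_apply, aeval_X, map_add, map_mul, AlgHom.restrictScalars_apply,
        Polynomial.coe_aeval_eq_eval, Polynomial.eval_C, Polynomial.eval_X]
    simpa [Q] using DFunLike.congr_fun this p
  -- Integer multiples of a period are periods, so this univariate polynomial vanishes at every
  -- natural number; in characteristic zero these are infinitely many roots.
  have h0 : Q - Polynomial.C (aeval y p) = 0 := by
    refine Polynomial.eq_zero_of_infinite_isRoot _
      ((Set.infinite_range_of_injective (Nat.cast_injective (R := MvPolynomial ι K))).mono ?_)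
    rintro _ ⟨j, rfl⟩
    have hj : aeval (fun i => y i + (j : MvPolynomial ι K) * C (v i)) p = aeval y p := by
      have hcomp : (aeval y).comp (translate (j • v)) =
          aeval (R := K) fun i => y i + (j : MvPolynomial ι K) * C (v i) := by
        ext1 i
        simp [algHom_C, algebraMap_eq]
      rw [← hcomp, AlgHom.comp_apply, translate_nsmul_eq_self h]
    rw [Set.mem_ofPred_eq, Polynomial.IsRoot.def, Polynomial.eval_sub, hQ, hj,
      Polynomial.eval_C, sub_self]
  rw [← hQ, sub_eq_zero.mp h0, Polynomial.eval_C]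

/-- A polynomial invariant under two translations is a univariate polynomial in `ℓ`, whenever
the generic point can be moved along the two directions to a multiple of `ℓ`. -/
theorem exists_eq_aeval_of_translate_eq_self [CharZero K] {v w r : ι → K}
    {p ℓ s t : MvPolynomial ι K} (hv : translate v p = p) (hw : translate w p = p)
    (h : ∀ i, X i + s * C (v i) + t * C (w i) = C (r i) * ℓ) :
    ∃ P : Polynomial K, p = Polynomial.aeval ℓ P := by
  -- The witness is the restriction of `p` to the line spanned by `r`.
  refine ⟨aeval (fun i => Polynomial.C (r i) * Polynomial.X) p, ?_⟩
  have hcomp : ((Polynomial.aeval ℓ).restrictScalars K).comp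
      (aeval (fun i => Polynomial.C (r i) * Polynomial.X)) =
      aeval (R := K) (fun i => C (r i) * ℓ) := by
    ext1 i
    simp [← algebraMap_eq]
  refine Eq.trans ?_ (DFunLike.congr_fun hcomp p).symm
  simp only [← h]
  rw [aeval_add_mul_of_translate_eq_self hw, aeval_add_mul_of_translate_eq_self hv]
  simp

end Translation

/-! ### Shifts as translations, summability and telescopers -/

section Shift

variable {K : Type*} [Field K]

theorem polyShift_eq_translate (v : Fin 3) (p : Poly3 K) :
    polyShift K v p = translate (Pi.single v 1) p := by
  have h : (polyShift K v : Poly3 K →ₐ[K] Poly3 K) = translate (Pi.single v 1) := by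
    ext1 i
    by_cases hi : i = v <;> simp [polyShift, hi]
  exact DFunLike.congr_fun h p

theorem polyShift_zpow (v : Fin 3) (j : ℤ) (p : Poly3 K) :
    (polyShift K v ^ j) p = translate (Pi.single v (j : K)) p := by
  have hinv (p : Poly3 K) : (polyShift K v)⁻¹ p = translate (Pi.single v (-1)) p := by
    apply (polyShift K v).injective
    rw [polyShift_eq_translate, polyShift_eq_translate, translate_translate, ← Pi.single_add,
      add_neg_cancel, Pi.single_zero, translate_zero, ← polyShift_eq_translate]
    exact (polyShift K v).apply_symm_apply p
  induction j generalizing p with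
  | zero => simp [translate_zero]
  | succ j ih =>
    rw [zpow_add_one, AlgEquiv.mul_apply, ih, polyShift_eq_translate, translate_translate,
      ← Pi.single_add, Int.cast_add, Int.cast_one]
  | pred j ih =>
    rw [zpow_sub_one, AlgEquiv.mul_apply, ih, hinv, translate_translate, ← Pi.single_add,
      Int.cast_sub, Int.cast_one, sub_eq_add_neg]

theorem ratShift_toRat (v : Fin 3) (p : Poly3 K) :
    ratShift K v (toRat K p) = toRat K (polyShift K v p) :=
  IsFractionRing.fieldEquivOfAlgEquiv_algebraMap K _ _ _ _

theorem ratShift_zpow_toRat (v : Fin 3) (j : ℤ) (p : Poly3 K) :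
    (ratShift K v ^ j) (toRat K p) = toRat K (translate (Pi.single v (j : K)) p) := by
  rw [← polyShift_zpow]
  induction j generalizing p with
  | zero => simp
  | succ j ih => simp only [zpow_add_one, AlgEquiv.mul_apply, ratShift_toRat, ih]
  | pred j ih =>
    have hinv : (ratShift K v)⁻¹ (toRat K p) = toRat K ((polyShift K v)⁻¹ p) := by
      apply (ratShift K v).injective
      rw [ratShift_toRat, ← AlgEquiv.mul_apply, ← AlgEquiv.mul_apply, mul_inv_cancel,
        mul_inv_cancel, AlgEquiv.one_apply, AlgEquiv.one_apply]
    simp only [zpow_sub_one, AlgEquiv.mul_apply, hinv, ih]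

/-- The `(σ_y, σ_z)`-summable rational functions. -/
noncomputable def summableSubmodule (K : Type*) [Field K] : Submodule K (Rat3 K) :=
  LinearMap.range ((ratShift K 1).toLinearMap - LinearMap.id) ⊔
    LinearMap.range ((ratShift K 2).toLinearMap - LinearMap.id)

theorem mem_summableSubmodule {f : Rat3 K} : f ∈ summableSubmodule K ↔ IsSummable f := by
  simp [summableSubmodule, Submodule.mem_sup, IsSummable, eq_comm]

/-- The difference is a telescoping sum of terms `±(σ w - w)`. -/
theorem zpow_apply_sub_self_mem {E : Type*} [Field E] [Algebra K E] {S : Submodule K E}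
    {σ : E ≃ₐ[K] E} (h : ∀ u, σ u - u ∈ S) (j : ℤ) (u : E) : (σ ^ j) u - u ∈ S := by
  induction j with
  | zero => simp
  | succ j ih =>
    have := S.add_mem (h ((σ ^ (j : ℤ)) u)) ih
    rwa [sub_add_sub_cancel, ← AlgEquiv.mul_apply, ← zpow_one_add, add_comm] at this
  | pred j ih =>
    have := S.sub_mem ih (h ((σ ^ (-(j : ℤ) - 1)) u))
    rwa [← AlgEquiv.mul_apply, ← zpow_one_add, add_sub_cancel, sub_sub_sub_cancel_left] at this

theorem ratShift_zpow_sub_mem {v : Fin 3} (hv : v ≠ 0) (j : ℤ) (u : Rat3 K) :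
    (ratShift K v ^ j) u - u ∈ summableSubmodule K := by
  refine zpow_apply_sub_self_mem (fun u => ?_) j u
  fin_cases v
  · exact absurd rfl hv
  · exact Submodule.mem_sup_left ⟨u, rfl⟩
  · exact Submodule.mem_sup_right ⟨u, rfl⟩

/-- The iterates of a polynomial under a translation are linearly dependent. -/
theorem not_linearIndependent_translate_pow {ι : Type*} [Finite ι] (v : ι → K)
    (p : MvPolynomial ι K) : ¬ LinearIndependent K fun i : ℕ => (translate v ^ i) p := by
  intro h
  let e : ℕ → restrictTotalDegree ι K p.totalDegree := fun i =>
    ⟨(translate v ^ i) p, by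
      rw [mem_restrictTotalDegree, translate_pow]; exact totalDegree_translate_le _ _⟩
  exact Module.Finite.not_linearIndependent_of_infinite e
    (LinearIndependent.of_comp (restrictTotalDegree ι K p.totalDegree).subtype h)

/-- Applying `i * j` shifts in `y` and `i * l` in `z` costs only summable terms and completes the
`x`-shift to the `i`-th power of the translation, which fixes `q`. -/
theorem ratShift_pow_div_sub_mem {M : ℕ} {j l : ℤ} {b q : Poly3 K}
    (hq : translate ![(M : K), (j : K), (l : K)] q = q) (i : ℕ) :
    (ratShift K 0 ^ (i * M)) (toRat K b / toRat K q) -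
      toRat K ((translate ![(M : K), (j : K), (l : K)] ^ i) b) / toRat K q
        ∈ summableSubmodule K := by
  set u := (ratShift K 0 ^ (i * M)) (toRat K b / toRat K q) with hu
  have hτ (p : Poly3 K) : (ratShift K 2 ^ (i * l)) ((ratShift K 1 ^ (i * j))
      ((ratShift K 0 ^ (i * M)) (toRat K p))) =
      toRat K (translate (i • ![(M : K), (j : K), (l : K)]) p) := by
    have hv : (Pi.single 2 ((i * l : ℤ) : K) + Pi.single 1 ((i * j : ℤ) : K) +
        Pi.single 0 (((i * M : ℕ) : ℤ) : K) : Fin 3 → K) = i • ![(M : K), (j : K), (l : K)] := by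
      ext t
      fin_cases t <;> simp
    rw [← zpow_natCast (ratShift K 0), ratShift_zpow_toRat, ratShift_zpow_toRat,
      ratShift_zpow_toRat, translate_translate, translate_translate, hv]
  have hi : toRat K ((translate ![(M : K), (j : K), (l : K)] ^ i) b) / toRat K q =
      (ratShift K 2 ^ (i * l)) ((ratShift K 1 ^ (i * j)) u) := by
    rw [hu, map_div₀, map_div₀, map_div₀, hτ, hτ, translate_nsmul_eq_self hq, translate_pow]
  rw [hi, ← neg_mem_iff, neg_sub, ← sub_add_sub_cancel _ ((ratShift K 1 ^ (i * j)) u)]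
  exact add_mem (ratShift_zpow_sub_mem (by decide) _ _) (ratShift_zpow_sub_mem (by decide) _ _)

/-- A rational function has a telescoper with constant coefficients if its denominator is fixed
by a composition of shifts involving a positive power of `σ_x`. -/
theorem hasTelescoper_div {M : ℕ} (hM : 0 < M) {j l : ℤ} (b : Poly3 K) {q : Poly3 K}
    (hq : translate ![(M : K), (j : K), (l : K)] q = q) :
    HasTelescoper (toRat K b / toRat K q) := by
  have h := not_linearIndependent_translate_pow ![(M : K), (j : K), (l : K)] b
  rw [linearIndependent_iff] at h
  push Not at h
  obtain ⟨a, ha, ha0⟩ := h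
  let F : K →+ ratX K := (algebraMap K (ratX K)).toAddMonoidHom
  have hinj : Function.Injective fun i : ℕ => i * M := fun i i' h => Nat.eq_of_mul_eq_mul_right hM h
  -- The dependency coefficient `a i` is placed at `S_x ^ (i * M)`; injectivity of `i ↦ i * M` keeps
  -- the operator nonzero.
  refine ⟨(Finsupp.mapRange F F.map_zero a).mapDomain (fun i => i * M), ?_, ?_⟩
  · rw [Ne, (Finsupp.mapDomain_injective hinj).eq_iff' Finsupp.mapDomain_zero]
    rwa [(Finsupp.mapRange_injective F F.map_zero
      (algebraMap K (ratX K)).injective).eq_iff' (Finsupp.mapRange_zero)]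
  · rw [← mem_summableSubmodule, RecOp.apply, Finsupp.sum_mapDomain_index (by simp)
      (by intros; simp [add_mul]), Finsupp.sum_mapRange_index (by simp)]
    have hz : a.sum (fun i x => x • (toRat K ((translate ![(M : K), (j : K), (l : K)] ^ i) b) /
        toRat K q)) = 0 := by
      rw [Finsupp.linearCombination_apply] at ha
      have := congrArg (fun p => (IsScalarTower.toAlgHom K (Poly3 K) (Rat3 K)) p / toRat K q) ha
      simpa [Finsupp.sum, Finset.sum_div, smul_div_assoc] using this
    -- Subtracting the dependency divided by `q` allows a termwise comparison.
    rw [← sub_zero (a.sum _), ← hz, Finsupp.sum, Finsupp.sum, ← Finset.sum_sub_distrib]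
    refine sum_mem fun i _ => ?_
    have := (summableSubmodule K).smul_mem (a i) (ratShift_pow_div_sub_mem (b := b) hq i)
    rw [smul_sub, Algebra.smul_def] at this
    exact this

end Shift

/-! ### Integer-linear factorizations and properness -/

section Proper

variable {K : Type*} [Field K]

/-- The total degree is one, and a common divisor of the coefficients divides a nonzero one, so it
is a unit. -/
theorem irreducible_linear {F : Type*} [Field F] {α β γ : F} (δ : F)
    (h : α ≠ 0 ∨ β ≠ 0 ∨ γ ≠ 0) :
    Irreducible (C α * X 0 + C β * X 1 + C γ * X 2 + C δ : Poly3 F) := by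
  set q : Poly3 F := C α * X 0 + C β * X 1 + C γ * X 2 + C δ with hq
  have hδ (i : Fin 3) : (C δ : Poly3 F).coeff (Finsupp.single i 1) = 0 := by
    rw [coeff_C, if_neg (Finsupp.single_ne_zero.mpr one_ne_zero).symm]
  obtain ⟨i, hi⟩ : ∃ i, q.coeff (Finsupp.single i 1) ≠ 0 := by
    rcases h with h | h | h
    · exact ⟨0, by simpa [hq, coeff_C_mul, coeff_X, hδ, Finsupp.single_left_inj] using h⟩
    · exact ⟨1, by simpa [hq, coeff_C_mul, coeff_X, hδ, Finsupp.single_left_inj] using h⟩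
    · exact ⟨2, by simpa [hq, coeff_C_mul, coeff_X, hδ, Finsupp.single_left_inj] using h⟩
  refine irreducible_of_totalDegree_eq_one (le_antisymm ?_ ?_) fun x hx => ?_
  · have hX (a : F) (i : Fin 3) : (C a * X i : Poly3 F).totalDegree ≤ 1 :=
      (totalDegree_mul _ _).trans (by simp)
    refine (totalDegree_add _ _).trans (max_le ?_ (by simp))
    refine (totalDegree_add _ _).trans (max_le ?_ (hX _ _))
    exact (totalDegree_add _ _).trans (max_le (hX _ _) (hX _ _))
  · simpa using le_totalDegree (mem_support_iff.mpr hi)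
  · exact isUnit_of_dvd_unit (hx _) hi.isUnit

/-- `p` is, up to a nonzero constant, a product of integer-linear polynomials over the algebraic
closure. -/
def IsIntegerLinearProduct (p : Poly3 K) : Prop :=
  ∃ u : K, u ≠ 0 ∧ ∃ s : Multiset (Poly3 (AlgebraicClosure K)), (∀ r ∈ s, IsIntegerLinear r) ∧
    MvPolynomial.map (algebraMap K (AlgebraicClosure K)) p =
      C (algebraMap K (AlgebraicClosure K) u) * s.prod

theorem IsIntegerLinearProduct.one : IsIntegerLinearProduct (1 : Poly3 K) :=
  ⟨1, one_ne_zero, 0, by simp, by simp⟩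

theorem IsIntegerLinearProduct.mul {p q : Poly3 K} (hp : IsIntegerLinearProduct p)
    (hq : IsIntegerLinearProduct q) : IsIntegerLinearProduct (p * q) := by
  obtain ⟨u, hu, s, hs, hp⟩ := hp
  obtain ⟨u', hu', s', hs', hq⟩ := hq
  refine ⟨u * u', mul_ne_zero hu hu', s + s', fun r hr => ?_, ?_⟩
  · exact (Multiset.mem_add.mp hr).elim (hs r) (hs' r)
  · rw [map_mul, hp, hq, Multiset.prod_add, map_mul, C_mul, mul_mul_mul_comm]

theorem IsIntegerLinearProduct.pow {p : Poly3 K} (hp : IsIntegerLinearProduct p) (n : ℕ) :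
    IsIntegerLinearProduct (p ^ n) := by
  induction n with
  | zero => simpa using IsIntegerLinearProduct.one
  | succ n ih => rw [pow_succ]; exact ih.mul hp

theorem IsIntegerLinearProduct.isProper {q : Poly3 K} (hq : IsIntegerLinearProduct q)
    (b : Poly3 K) : IsProper (toRat K b / toRat K q) := by
  obtain ⟨u, hu, s, hs, hq⟩ := hq
  -- Properness allows no constant in front of the product, so `u` is moved to the numerator.
  refine ⟨C u⁻¹ * b, C u⁻¹ * q, ?_, s, hs, ?_⟩
  · rw [map_mul, map_mul, mul_div_mul_left]
    rw [Ne, map_eq_zero_iff _ (IsFractionRing.injective _ _), C_eq_zero]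
    exact inv_ne_zero hu
  · rw [map_mul, hq, map_C, ← mul_assoc, ← C_mul, ← map_mul, inv_mul_cancel₀ hu, map_one, C_1,
      one_mul]

/-- Over the algebraic closure `P` splits, and each root `a` contributes the factor `ℓ - a`; the
leading coefficient is the constant. -/
theorem isIntegerLinearProduct_aeval [CharZero K] {α β γ : ℤ} (h : α ≠ 0 ∨ β ≠ 0 ∨ γ ≠ 0)
    {P : Polynomial K} (hP : P ≠ 0) :
    IsIntegerLinearProduct (Polynomial.aeval
      (C (α : K) * X 0 + C (β : K) * X 1 + C (γ : K) * X 2 : Poly3 K) P) := by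
  set ℓ : Poly3 K := C (α : K) * X 0 + C (β : K) * X 1 + C (γ : K) * X 2 with hℓ
  let φ := algebraMap K (AlgebraicClosure K)
  let ℓ' : Poly3 (AlgebraicClosure K) := MvPolynomial.map φ ℓ
  have hℓ' : ℓ' = C (α : AlgebraicClosure K) * X 0 + C (β : AlgebraicClosure K) * X 1 +
      C (γ : AlgebraicClosure K) * X 2 := by
    simp [ℓ', hℓ]
  have hmap : MvPolynomial.map φ (Polynomial.aeval ℓ P) = Polynomial.aeval ℓ' (P.map φ) := by
    rw [Polynomial.aeval_def, Polynomial.hom_eval₂, Polynomial.aeval_def, Polynomial.eval₂_map]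
    congr 1
    ext a
    simp [algebraMap_eq]
  have hsplit := (IsAlgClosed.splits (P.map φ)).eq_prod_roots
  refine ⟨P.leadingCoeff, by simpa using hP,
    (P.map φ).roots.map fun a => ℓ' - C a, fun r hr => ?_, ?_⟩
  · obtain ⟨a, -, rfl⟩ := Multiset.mem_map.mp hr
    rw [hℓ', sub_eq_add_neg, ← C_neg]
    refine ⟨irreducible_linear _ ?_, α, β, γ, -a, rfl⟩
    exact_mod_cast h
  · change MvPolynomial.map φ _ = _
    rw [hmap]
    nth_rewrite 1 [hsplit]
    rw [map_mul, Polynomial.aeval_C, map_multiset_prod, Multiset.map_map,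
      Polynomial.leadingCoeff_map, algebraMap_eq]
    simp [algebraMap_eq, φ]

theorem isIntegerLinearProduct_of_translate_eq_self [CharZero K] {v w r : Fin 3 → K}
    {α β γ : ℤ} (h : α ≠ 0 ∨ β ≠ 0 ∨ γ ≠ 0) {p s t : Poly3 K} (hp : p ≠ 0)
    (hv : translate v p = p) (hw : translate w p = p)
    (hst : ∀ i, X i + s * C (v i) + t * C (w i) =
      C (r i) * (C (α : K) * X 0 + C (β : K) * X 1 + C (γ : K) * X 2)) :
    IsIntegerLinearProduct p := by
  obtain ⟨P, rfl⟩ := exists_eq_aeval_of_translate_eq_self hv hw hst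
  exact isIntegerLinearProduct_aeval h (by rintro rfl; simp at hp)

theorem translate_eq_self_of_mem_supported {p : Poly3 K}
    (hp : p ∈ MvPolynomial.supported K ({0, 1} : Set (Fin 3))) (a : K) :
    translate (Pi.single 2 a) p = p := by
  refine (eval₂Hom_congr' rfl (fun i hi _ => ?_) rfl).trans (aeval_X_left_apply p)
  have := mem_supported.mp hp hi
  have hi2 : i ≠ 2 := by rintro rfl; simp at this
  simp [hi2]

/-- A polynomial in `x, y` with a period `(a, -l, 0)`, `a ≠ 0`, is a product of integer-linear
polynomials. -/
theorem isIntegerLinearProduct_of_supported [CharZero K] {p : Poly3 K} (hp : p ≠ 0)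
    (hs : p ∈ MvPolynomial.supported K ({0, 1} : Set (Fin 3))) {a l : ℤ} (ha : a ≠ 0)
    (h : translate ![(a : K), ((-l : ℤ) : K), 0] p = p) : IsIntegerLinearProduct p := by
  have haK : (a : K) ≠ 0 := by exact_mod_cast ha
  have hC : (C (a : K)⁻¹ * (a : Poly3 K)) = 1 := by
    rw [← map_intCast (C : K →+* Poly3 K) a, ← C_mul, inv_mul_cancel₀ haK, C_1]
  -- The form `l x + a y` kills both periods, the second being the `z`-direction; `s` and `t` move
  -- the generic point to `x = z = 0`.
  refine isIntegerLinearProduct_of_translate_eq_self (α := l) (β := a) (γ := 0)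
    (r := ![0, (a : K)⁻¹, 0]) (s := -C (a : K)⁻¹ * X 0) (t := -X 2) (.inr (.inl ha)) hp h
    (translate_eq_self_of_mem_supported hs 1) fun i => ?_
  fin_cases i
  · simp; linear_combination (-X 0) * hC
  · simp; linear_combination (-X 1) * hC
  · simp

/-- A polynomial with periods `(a, -j, -l)` and `(0, e, -g)`, `a, e ≠ 0`, is a product of
integer-linear polynomials. -/
theorem isIntegerLinearProduct_of_translate [CharZero K] {p : Poly3 K} (hp : p ≠ 0)
    {a j l e g : ℤ} (ha : a ≠ 0) (he : e ≠ 0)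
    (h : translate ![(a : K), ((-j : ℤ) : K), ((-l : ℤ) : K)] p = p)
    (h' : translate ![(0 : K), (e : K), ((-g : ℤ) : K)] p = p) :
    IsIntegerLinearProduct p := by
  have haK : (a : K) ≠ 0 := by exact_mod_cast ha
  have heK : (e : K) ≠ 0 := by exact_mod_cast he
  have hCa : (C (a : K)⁻¹ * (a : Poly3 K)) = 1 := by
    rw [← map_intCast (C : K →+* Poly3 K) a, ← C_mul, inv_mul_cancel₀ haK, C_1]
  have hCe : (C (e : K)⁻¹ * (e : Poly3 K)) = 1 := by
    rw [← map_intCast (C : K →+* Poly3 K) e, ← C_mul, inv_mul_cancel₀ heK, C_1]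
  -- The form is the cross product of the two periods; `s` clears the `x`-coordinate, then `t` the
  -- `y`-coordinate.
  refine isIntegerLinearProduct_of_translate_eq_self (α := j * g + l * e) (β := g * a)
    (γ := a * e) (r := ![0, 0, (a : K)⁻¹ * (e : K)⁻¹]) (s := -C (a : K)⁻¹ * X 0)
    (t := -C (e : K)⁻¹ * (X 1 + C (a : K)⁻¹ * C (j : K) * X 0))
    (.inr (.inr (mul_ne_zero ha he))) hp h h' fun i => ?_
  fin_cases i
  · simp; linear_combination (-X 0) * hCa
  · simp; linear_combination (-X 1 - C (a : K)⁻¹ * (j : Poly3 K) * X 0) * hCe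
  · simp
    linear_combination (-X 2 * C (e : K)⁻¹ * (e : Poly3 K) - C (e : K)⁻¹ * (g : Poly3 K) * X 1) * hCa +
      (-X 2 - C (a : K)⁻¹ * (l : Poly3 K) * X 0) * hCe

end Proper

/-! ### From shift identities to periods -/

section

variable {K : Type*} [Field K]

theorem translate_eq_self_of_polyShift_eq {p : Poly3 K} {a j l : ℤ}
    (h : (polyShift K 0 ^ a) p = (polyShift K 1 ^ j) ((polyShift K 2 ^ l) p)) :
    translate ![(a : K), ((-j : ℤ) : K), ((-l : ℤ) : K)] p = p := by
  rw [polyShift_zpow, polyShift_zpow, polyShift_zpow, translate_translate] at h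
  convert translate_eq_self_of_add h using 2
  congr 1
  ext i
  fin_cases i <;> simp

theorem translate_eq_self_of_polyShift_eq' {p : Poly3 K} {e g : ℤ}
    (h : (polyShift K 1 ^ e) p = (polyShift K 2 ^ g) p) :
    translate ![(0 : K), (e : K), ((-g : ℤ) : K)] p = p := by
  rw [polyShift_zpow, polyShift_zpow] at h
  convert translate_eq_self_of_add h using 2
  congr 1
  ext i
  fin_cases i <;> simp

end

end Telescoper
open Telescoper

theorem mainTheorem5 {K : Type*} [Field K] [CharZero K]
    (b c d : Telescoper.Poly3 K)
    (hc : c ∈ MvPolynomial.supported K ({0, 1} : Set (Fin 3)))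
    (hc0 : c ≠ 0) (hd0 : d ≠ 0) (lam : ℕ)
    (m n k : ℤ) (hm : 0 < m)
    (hd : (Telescoper.polyShift K 0 ^ m) d
      = (Telescoper.polyShift K 1 ^ n) ((Telescoper.polyShift K 2 ^ k) d))
    (f : Telescoper.Rat3 K)
    (hf : f = Telescoper.toRat K b / (Telescoper.toRat K c * Telescoper.toRat K d ^ lam)) :
    ((∃ n₁ n₂ k₁ k₂ : ℤ, 0 < n₁ ∧ 0 < n₂ ∧
        (Telescoper.polyShift K 1 ^ n₁) d = (Telescoper.polyShift K 2 ^ k₁) d ∧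
        (Telescoper.polyShift K 0 ^ n₂) c = (Telescoper.polyShift K 1 ^ k₂) c) →
      Telescoper.IsProper f ∧ Telescoper.HasTelescoper f) ∧
    ((∃ t : ℤ, 0 < t ∧
        (Telescoper.polyShift K 0 ^ (t * m)) c = (Telescoper.polyShift K 1 ^ (t * n)) c) →
      Telescoper.HasTelescoper f) := by
  have hvd := translate_eq_self_of_polyShift_eq hd
  have hfq : f = toRat K b / toRat K (c * d ^ lam) := by rw [hf, map_mul, map_pow]
  have hcz (a : K) := translate_eq_self_of_mem_supported hc a
  have hperiod {a j : ℤ} (h : (polyShift K 0 ^ a) c = (polyShift K 1 ^ j) c) :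
      translate ![(a : K), ((-j : ℤ) : K), 0] c = c := by
    have := translate_eq_self_of_polyShift_eq (p := c) (a := a) (j := j) (l := 0) (by simpa using h)
    simpa using this
  -- As `c` is free of `z`, the last entry of its period is arbitrary.
  have hper {a j : ℤ} (l : ℤ) (h : translate ![(a : K), ((-j : ℤ) : K), 0] c = c) :
      translate ![(a : K), ((-j : ℤ) : K), (l : K)] c = c := by
    have := congrArg (Telescoper.translate (Pi.single 2 (l : K))) h
    rw [Telescoper.translate_translate, hcz] at this
    convert this using 3
    ext i
    fin_cases i <;> simp
  have htel {a j l : ℤ} (ha : 0 < a)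
      (hc : translate ![(a : K), (j : K), (l : K)] c = c)
      (hd : translate ![(a : K), (j : K), (l : K)] d = d) : HasTelescoper f := by
    lift a to ℕ using ha.le
    rw [hfq]
    refine hasTelescoper_div (M := a) (j := j) (l := l) (by exact_mod_cast ha) b ?_
    rw [map_mul, map_pow]
    rw [Int.cast_natCast] at hc hd
    rw [hc, hd]
  refine ⟨?_, ?_⟩
  · rintro ⟨n₁, n₂, k₁, k₂, hn₁, hn₂, hd₁, hc₂⟩
    have hwd := translate_eq_self_of_polyShift_eq' hd₁
    have hvc := hperiod hc₂
    refine ⟨?_, ?_⟩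
    · rw [hfq]
      exact ((isIntegerLinearProduct_of_supported hc0 hc hn₂.ne' hvc).mul
        ((isIntegerLinearProduct_of_translate hd0 hm.ne' hn₁.ne' hvd hwd).pow lam)).isProper b
    -- The multipliers give the periods of `c` and `d` the same `x`-entry `m * n₁ * n₂`; the
    -- multiple of `(0, n₁, -k₁)` then corrects the `y`-entry for `d` to `-(m * n₁ * k₂)`.
    · have h₁ := translate_zsmul_eq_self hvc (m * n₁)
      have h₂ := translate_zsmul_eq_self hvd (n₁ * n₂)
      have h₃ := translate_zsmul_eq_self hwd (n * n₂ - m * k₂)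
      have h₄ := congrArg (Telescoper.translate ((n₁ * n₂) • ![(m : K), ((-n : ℤ) : K), ((-k : ℤ) : K)])) h₃
      rw [Telescoper.translate_translate, h₂] at h₄
      refine htel (a := m * n₁ * n₂) (j := -(m * n₁ * k₂))
        (l := -(n₁ * n₂ * k) - (n * n₂ - m * k₂) * k₁) (by positivity) ?_ ?_
      · refine hper _ ?_
        convert h₁ using 3
        ext i
        fin_cases i <;> simp [mul_assoc]
      · convert h₄ using 3
        ext i
        fin_cases i <;> simp <;> ring
  · rintro ⟨t, ht, hct⟩
    have h₂ := translate_zsmul_eq_self hvd t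
    refine htel (a := t * m) (j := -(t * n)) (l := -(t * k)) (by positivity)
      (hper _ (hperiod hct)) ?_
    convert h₂ using 3
    ext i
    fin_cases i <;> simp
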